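/- Let $k$ be a field. Conventions: for a simplicial scheme $Y_\bullet$ over a scheme $X$, $\operatorname{sk}_n^X(Y_\bullet)$ denotes the $n$-truncation and $\operatorname{cosk}_n^X$ the right adjoint of truncation on simplicial $X$-schemes, and $\operatorname{cosk}_{-1}^X(\operatorname{sk}_{-1}^X(Y_\bullet))_0:=X$. The morphism $Y_\bullet\to X$ is an étale hypercovering if every $Y_n$ is separated of finite type over $X$ and the canonical morphism $Y_{n+1}\to\operatorname{cosk}_n^X(\operatorname{sk}_n^X(Y_\bullet))_{n+1}$ is étale and surjective for every $n\ge -1$. A refinement of an étale hypercovering $Z_\bullet\to X$ is a morphism $f\colon Y_\bullet\to Z_\bullet$ of simplicial $X$-schemes such that $Y_\bullet\to X$ is an étale hypercovering and, for every $n\ge -1$, the induced morphism $$Y_{n+1}\to \operatorname{cosk}_n^X(\operatorname{sk}_n^X(Y_\bullet))_{n+1}\times_{\operatorname{cosk}_n^X(\operatorname{sk}_n^X(Z_\bullet))_{n+1}} Z_{n+1}$$ is étale and surjective (for $n=-1$ this is $Y_0\to Z_0$). A $k$-scheme is affine standard smooth if it is isomorphic to $\operatorname{Spec} A$ with $A\cong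 k[X_1,\dots,X_n]/(f_1,\dots,f_m)$, $m\le n$, such that $\det(\partial f_i/\partial X_j)_{1\le i,j\le m}$ is a unit in $A$. **Proposition.** Let $X$ be a quasi-compact $k$-scheme (for instance, one of finite type over $k$) and let $Z_\bullet\to X$ be an étale hypercovering such that every $Z_n$ is smooth over $k$. Then there exist an étale hypercovering $Y_\bullet\to X$ and a refinement $f\colon Y_\bullet\to Z_\bullet$ over $X$ such that for every $n\ge 0$ there is a finite open covering $Z_n=U_{n,1}\cup\dots\cup U_{n,r_n}$ by open subschemes that are affine standard smooth over $k$, and an isomorphism $Y_n\cong\bigsqcup_{i=1}^{r_n} U_{n,i}$ under which $f_n\colon Y_n\to Z_n$ is the morphism given by the inclusions $U_{n,i}\subseteq Z_n$. -/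

import Mathlib

open CategoryTheory CategoryTheory.Limits AlgebraicGeometry Opposite Simplicial

universe u

namespace EtaleHypercovering

section Coskeleton

instance finite_simplexHom (a b : SimplexCategory) : Finite (a ⟶ b) :=
  Finite.of_injective (fun f : a ⟶ b ↦ (f.toOrderHom : Fin (a.len + 1) → Fin (b.len + 1)))
    fun f g h ↦ SimplexCategory.Hom.ext f g (OrderHom.ext _ _ h)

instance finite_structuredArrow (n : ℕ) (Δ : SimplexCategoryᵒᵖ) :
    Finite (StructuredArrow Δ (SimplexCategory.Truncated.inclusion n).op) := by
  let ob (m : Fin (n + 1)) : (SimplexCategory.Truncated n)ᵒᵖ :=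
    op ⟨⦋m.1⦌, Nat.lt_succ_iff.mp m.2⟩
  let φ : (Σ m : Fin (n + 1), (⦋m.1⦌ ⟶ Δ.unop)) →
      StructuredArrow Δ (SimplexCategory.Truncated.inclusion n).op := fun x ↦
    StructuredArrow.mk (S := Δ) (T := (SimplexCategory.Truncated.inclusion n).op)
      (Y := ob x.1) (show Δ ⟶ op ⦋x.1.1⦌ from x.2.op)
  refine Finite.of_surjective φ fun g ↦ ?_
  exact ⟨⟨⟨g.right.unop.obj.len, Nat.lt_succ_iff.mpr g.right.unop.property⟩, g.hom.unop⟩, rfl⟩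

instance finite_structuredArrowHom (n : ℕ) (Δ : SimplexCategoryᵒᵖ)
    (g h : StructuredArrow Δ (SimplexCategory.Truncated.inclusion n).op) : Finite (g ⟶ h) :=
  Finite.of_injective (fun f : g ⟶ h ↦
      ((SimplexCategory.Truncated.inclusion n).map f.right.unop : _ ⟶ _))
    fun _ _ e ↦ StructuredArrow.hom_ext _ _ (Quiver.Hom.unop_inj
      ((SimplexCategory.Truncated.inclusion n).map_injective e))

noncomputable instance finCategory_structuredArrow (n : ℕ) (Δ : SimplexCategoryᵒᵖ) :
    FinCategory (StructuredArrow Δ (SimplexCategory.Truncated.inclusion n).op) where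
  fintypeObj := Fintype.ofFinite _
  fintypeHom _ _ := Fintype.ofFinite _

variable {C : Type*} [Category* C] [HasFiniteLimits C]

/-- Coskeleta exist in a category with finite limits, and are computed pointwise. -/
instance hasPointwiseRightKanExtension (n : ℕ)
    (F : (SimplexCategory.Truncated n)ᵒᵖ ⥤ C) :
    (SimplexCategory.Truncated.inclusion n).op.HasPointwiseRightKanExtension F :=
  fun Δ ↦ by
    dsimp only [Functor.HasPointwiseRightKanExtensionAt]
    infer_instance

/-- The canonical morphism `Y ⟶ cosk_n (sk_n Y)`, where `sk_n` is the `n`-truncation: the unit of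
the adjunction between truncation and coskeleton. -/
noncomputable def toCosk (n : ℕ) (Y : SimplicialObject C) :
    Y ⟶ (SimplicialObject.cosk n).obj Y :=
  ((SimplexCategory.Truncated.inclusion n).op.ranAdjunction C).unit.app Y

/-- The canonical morphism
`V_{n+1} ⟶ cosk_n (sk_n V)_{n+1} ×_{cosk_n (sk_n Y)_{n+1}} Y_{n+1}` of a morphism `V ⟶ Y`. -/
noncomputable def toRelativeCosk {V Y : SimplicialObject C} (f : V ⟶ Y) (n : ℕ) :
    V _⦋n + 1⦌ ⟶ pullback (((SimplicialObject.cosk n).map f).app (op ⦋n + 1⦌))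
      ((toCosk n Y).app (op ⦋n + 1⦌)) :=
  pullback.lift ((toCosk n V).app (op ⦋n + 1⦌)) (f.app (op ⦋n + 1⦌)) (by
    have h := congrArg (fun α ↦ α.app (op ⦋n + 1⦌))
      (((SimplexCategory.Truncated.inclusion n).op.ranAdjunction C).unit.naturality f)
    exact h.symm)

end Coskeleton

/-- A simplicial scheme `Y` over `X` is an étale hypercovering if all `Y_n` are separated of finite
type over `X` and `Y_{n+1} ⟶ cosk_n^X (sk_n^X Y)_{n+1}` is étale surjective for all `n ≥ -1`.
For `n = -1` this morphism is `Y_0 ⟶ X`; the coskeleta are taken in schemes over `X`. -/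
structure IsEtaleHypercovering {X : Scheme.{u}} (Y : SimplicialObject (Over X)) : Prop where
  isSeparated (n : ℕ) : IsSeparated (Y _⦋n⦌).hom
  locallyOfFiniteType (n : ℕ) : LocallyOfFiniteType (Y _⦋n⦌).hom
  quasiCompact (n : ℕ) : QuasiCompact (Y _⦋n⦌).hom
  etale_zero : Etale (Y _⦋0⦌).hom
  surjective_zero : Surjective (Y _⦋0⦌).hom
  etale_succ (n : ℕ) : Etale ((toCosk n Y).app (op ⦋n + 1⦌)).left
  surjective_succ (n : ℕ) : Surjective ((toCosk n Y).app (op ⦋n + 1⦌)).left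

/-- A morphism `f : V ⟶ Y` of simplicial schemes over `X` exhibits `V` as a refinement of `Y` if
`V` is an étale hypercovering of `X` and
`V_{n+1} ⟶ cosk_n^X (sk_n^X V)_{n+1} ×_{cosk_n^X (sk_n^X Y)_{n+1}} Y_{n+1}` is étale surjective for
all `n ≥ -1`. For `n = -1` this morphism is `V_0 ⟶ X ×_X Y_0 = Y_0`. -/
structure IsRefinement {X : Scheme.{u}} {V Y : SimplicialObject (Over X)} (f : V ⟶ Y) : Prop where
  isEtaleHypercovering : IsEtaleHypercovering V
  etale_zero : Etale (f.app (op ⦋0⦌)).left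
  surjective_zero : Surjective (f.app (op ⦋0⦌)).left
  etale_succ (n : ℕ) : Etale (toRelativeCosk f n).left
  surjective_succ (n : ℕ) : Surjective (toRelativeCosk f n).left

/-- A `k`-scheme is (affine) standard smooth if it is the spectrum of a standard smooth
`k`-algebra, that is, of some `k[X_1, …, X_n] / (f_1, …, f_m)` with `m ≤ n` in which the Jacobian
determinant of the `f_i` with respect to `m` of the variables is a unit. -/
def IsStandardSmoothScheme (k : Type u) [CommRing k] (U : Scheme.{u})
    (s : U ⟶ Spec (CommRingCat.of k)) : Prop :=
  ∃ (A : Type u) (_ : CommRing A) (_ : Algebra k A), Algebra.IsStandardSmooth k A ∧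
    ∃ e : U ≅ Spec (CommRingCat.of A),
      e.hom ≫ Spec.map (CommRingCat.ofHom (algebraMap k A)) = s

end EtaleHypercovering

/-!
All schemes `Z_n` of an étale hypercovering are étale over `X`: the coskeleta are finite limits of
étale `X`-schemes, so this follows by induction on `n` (`IsEtaleHypercovering.etale`). Hence all
simplicial operators of `Z` are étale, and the degeneracies, being sections of étale morphisms, are
open immersions (`isOpenImmersion_map_left`). In particular the image of a standard smooth open
subscheme under a degeneracy is again a standard smooth open subscheme.

Since the `Z_n` are noetherian with a basis of standard smooth opens, one can choose, by recursion
on `n`, finite sets `B_n` of standard smooth opens of `Z_n` that are stable under degeneracies and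
such that, for `V_0, …, V_{n+1}` in `B_n`, the intersection of the `d_i⁻¹(V_i)` is a union of members
of `B_{n+1}` (`exists_isCoveringBasis`). A simplex of dimension `n` of the index set of the
refinement is a *system*: a map that sends every simplex `θ : Γ ⟶ Δ^n` to a member `t θ` of `B_Γ`,
compatibly with the simplicial operators, and such that `t` of a degenerate simplex is the image of
`t` of the simplex that it degenerates. A system is determined by its values on nondegenerate
simplices, so there are finitely many (`SetSystem.finite`), and systems pull back along simplicial
operators. Put `Y_n = ∐ t, t(id)`, the sum over all systems on `Δ^n`.

Two extension properties of systems give the theorem. The opens `t(id)` cover `Z_n`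
(`IsCoveringBasis.exists_mem_top`), and a matching family of systems on the proper faces of
`Δ^{n+1}`, together with a point of `Z_{n+1}` whose faces lie in the corresponding opens, extends to
a system `t` on `Δ^{n+1}` with that point in `t(id)` (`IsCoveringBasis.exists_extension`). The
functor of points with values in a field commutes with the limits that define the coskeleta, so the
second property shows that
`Y_{n+1} ⟶ cosk_n(Y)_{n+1} ×_{cosk_n(Z)_{n+1}} Z_{n+1}` is surjective
(`HasOpenMembers.surjective_toRelativeCosk`). It is étale as a morphism between étale `X`-schemes.
The surjectivity of `Y_{n+1} ⟶ cosk_n(Y)_{n+1}` follows by base change from that for `Z`.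
-/

set_option maxSynthPendingDepth 3

namespace EtaleHypercovering

/-! ### Systems of open sets on a simplicial set -/

/-- The factorization of a morphism of the simplex category as an epimorphism followed by a
monomorphism is unique on the nose, because the simplex category is skeletal. -/
lemma epi_mono_factorization_unique {Γ Γ₁ Γ₂ Δ : SimplexCategory} (e₁ : Γ ⟶ Γ₁) (i₁ : Γ₁ ⟶ Δ)
    (e₂ : Γ ⟶ Γ₂) (i₂ : Γ₂ ⟶ Δ) [Epi e₁] [Epi e₂] [Mono i₁] [Mono i₂]
    (h : e₁ ≫ i₁ = e₂ ≫ i₂) :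
    ∃ h : Γ₁ = Γ₂, e₁ ≫ eqToHom h = e₂ ∧ eqToHom h ≫ i₂ = i₁ := by
  obtain rfl : Γ₁ = Γ₂ :=
    (SimplexCategory.image_eq h).symm.trans (SimplexCategory.image_eq (rfl : e₂ ≫ i₂ = _))
  have := strongEpi_of_epi e₁
  have sq : CommSq e₂ e₁ i₂ i₁ := ⟨h.symm⟩
  have := mono_of_mono_fac sq.fac_right
  have hl := SimplexCategory.eq_id_of_mono sq.lift
  refine ⟨rfl, ?_, ?_⟩
  · rw [eqToHom_refl, ← hl, sq.fac_left]
  · rw [eqToHom_refl, ← hl, sq.fac_right]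

/-- A finite family `B Γ` of subsets of `S_Γ`, for every `Γ`, that is rich enough to refine
coverings degree by degree: it covers `S_0`, is stable under taking images by degeneracies, and the
intersection of the inverse images under the faces `S_{n+1} → S_n` of members of `B ⦋n⦌` is a union
of members of `B ⦋n + 1⦌`. -/
structure IsCoveringBasis (S : SSet.{u})
    (B : ∀ Γ : SimplexCategory, Set (Set (S.obj (op Γ)))) : Prop where
  finite (Γ : SimplexCategory) : (B Γ).Finite
  exists_mem_zero (x : S _⦋0⦌) : ∃ V ∈ B ⦋0⦌, x ∈ V
  image_mem {Γ Γ' : SimplexCategory} (φ : Γ' ⟶ Γ) [Epi φ] (V : Set (S.obj (op Γ)))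
    (hV : V ∈ B Γ) : S.map φ.op '' V ∈ B Γ'
  exists_mem_succ (n : ℕ) (V : Fin (n + 2) → Set (S _⦋n⦌)) (hV : ∀ i, V i ∈ B ⦋n⦌)
    (x : S _⦋n + 1⦌) (hx : ∀ i, S.δ i x ∈ V i) :
    ∃ W ∈ B ⦋n + 1⦌, x ∈ W ∧ ∀ i, Set.MapsTo (S.δ i) W (V i)

/-- A system of members of `B` on the standard simplex `Δ`: a set `t θ ⊆ S_Γ` for every simplex
`θ : Γ ⟶ Δ`, compatible with all simplicial operators, and such that the set attached to a
degenerate simplex is the image of the set attached to the simplex that it degenerates. -/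
@[ext]
structure SetSystem (S : SSet.{u}) (B : ∀ Γ : SimplexCategory, Set (Set (S.obj (op Γ))))
    (Δ : SimplexCategory) where
  /-- The set attached to a simplex. -/
  set ⦃Γ : SimplexCategory⦄ (θ : Γ ⟶ Δ) : Set (S.obj (op Γ))
  set_mem ⦃Γ : SimplexCategory⦄ (θ : Γ ⟶ Δ) : set θ ∈ B Γ
  mapsTo ⦃Γ Γ' : SimplexCategory⦄ (φ : Γ' ⟶ Γ) (θ : Γ ⟶ Δ) :
    Set.MapsTo (S.map φ.op) (set θ) (set (φ ≫ θ))
  set_comp_of_epi ⦃Γ Γ' : SimplexCategory⦄ (φ : Γ' ⟶ Γ) [Epi φ] (θ : Γ ⟶ Δ) :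
    set (φ ≫ θ) = S.map φ.op '' set θ

namespace SetSystem

variable {S : SSet.{u}} {B : ∀ Γ : SimplexCategory, Set (Set (S.obj (op Γ)))}

/-- The restriction of a system along a morphism of the simplex category. -/
@[simps]
def pullback {Δ Δ' : SimplexCategory} (t : SetSystem S B Δ) (ψ : Δ' ⟶ Δ) :
    SetSystem S B Δ' where
  set _ θ := t.set (θ ≫ ψ)
  set_mem _ θ := t.set_mem _
  mapsTo _ _ φ θ := by simpa using t.mapsTo φ (θ ≫ ψ)
  set_comp_of_epi _ _ φ _ θ := by simpa using t.set_comp_of_epi φ (θ ≫ ψ)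

lemma pullback_id {Δ : SimplexCategory} (t : SetSystem S B Δ) : t.pullback (𝟙 Δ) = t := by
  ext; simp

lemma pullback_comp {Δ Δ' Δ'' : SimplexCategory} (t : SetSystem S B Δ) (ψ : Δ' ⟶ Δ)
    (ψ' : Δ'' ⟶ Δ') : t.pullback (ψ' ≫ ψ) = (t.pullback ψ).pullback ψ' := by
  ext; simp

/-- The set attached to the nondegenerate top-dimensional simplex. -/
def top {Δ : SimplexCategory} (t : SetSystem S B Δ) : Set (S.obj (op Δ)) := t.set (𝟙 Δ)

lemma top_mem {Δ : SimplexCategory} (t : SetSystem S B Δ) : t.top ∈ B Δ := t.set_mem _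

lemma mapsTo_top {Δ Δ' : SimplexCategory} (t : SetSystem S B Δ) (ψ : Δ' ⟶ Δ) :
    Set.MapsTo (S.map ψ.op) t.top (t.pullback ψ).top := by
  simpa [top] using t.mapsTo ψ (𝟙 Δ)

/-- A system is determined by its values on the finitely many nondegenerate simplices. -/
lemma finite (hB : IsCoveringBasis S B) (Δ : SimplexCategory) : Finite (SetSystem S B Δ) := by
  have (m : ℕ) : Finite (B ⦋m⦌) := hB.finite _
  let F (t : SetSystem S B Δ) (m : Fin (Δ.len + 1)) (θ : ⦋m.1⦌ ⟶ Δ) : B ⦋m.1⦌ :=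
    ⟨t.set θ, t.set_mem θ⟩
  refine Finite.of_injective F fun t t' h ↦ ?_
  ext Γ θ : 3
  have hι : t.set (image.ι θ) = t'.set (image.ι θ) :=
    congrArg Subtype.val (congrFun (congrFun h ⟨(image θ).len,
      Nat.lt_succ_of_le (SimplexCategory.len_le_of_mono (image.ι θ))⟩) (image.ι θ))
  rw [← image.fac θ, t.set_comp_of_epi, t'.set_comp_of_epi, hι]

end SetSystem

variable {S : SSet.{u}} {B : ∀ Γ : SimplexCategory, Set (Set (S.obj (op Γ)))}

namespace IsCoveringBasis

/-- Every point of `S` has a neighbourhood in `B`, chosen so that the faces of the neighbourhood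
of a point are contained in the neighbourhoods of the faces of the point. -/
lemma exists_nhd (hB : IsCoveringBasis S B) :
    ∃ c : ∀ n : ℕ, S _⦋n⦌ → Set (S _⦋n⦌), (∀ n x, c n x ∈ B ⦋n⦌) ∧ (∀ n x, x ∈ c n x) ∧
      ∀ n x (i : Fin (n + 2)), Set.MapsTo (S.δ i) (c (n + 1) x) (c n (S.δ i x)) := by
  choose c₀ h₀ h₀' using hB.exists_mem_zero
  choose d h₁ h₂ h₃ using hB.exists_mem_succ
  -- In degree `n + 1`, the neighbourhood of `x` is chosen inside the inverse images of the
  -- neighbourhoods of the faces of `x`.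
  let c : ∀ n : ℕ, {c : S _⦋n⦌ → Set (S _⦋n⦌) // ∀ x, c x ∈ B ⦋n⦌ ∧ x ∈ c x} := fun n ↦
    Nat.rec ⟨c₀, fun x ↦ ⟨h₀ x, h₀' x⟩⟩ (fun n c ↦
      ⟨fun x ↦ d n (fun i ↦ c.1 (S.δ i x)) (fun i ↦ (c.2 _).1) x (fun i ↦ (c.2 _).2),
        fun x ↦ ⟨h₁ .., h₂ ..⟩⟩) n
  exact ⟨fun n ↦ (c n).1, fun n x ↦ ((c n).2 x).1, fun n x ↦ ((c n).2 x).2,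
    fun n x i ↦ h₃ n _ _ x _ i⟩

/-- The property of `exists_nhd` for faces of arbitrary codimension. -/
lemma mapsTo_nhd_of_mono (c : ∀ n : ℕ, S _⦋n⦌ → Set (S _⦋n⦌))
    (hc : ∀ n x (i : Fin (n + 2)), Set.MapsTo (S.δ i) (c (n + 1) x) (c n (S.δ i x)))
    {Γ : SimplexCategory} (n : ℕ) (ι : Γ ⟶ ⦋n⦌) [Mono ι] (x : S _⦋n⦌) :
    Set.MapsTo (S.map ι.op) (c n x) (c Γ.len (S.map ι.op x)) := by
  induction n with
  | zero =>
    obtain rfl : Γ = ⦋0⦌ := by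
      ext; simpa using SimplexCategory.len_le_of_mono ι
    obtain rfl := SimplexCategory.eq_id_of_mono ι
    intro y hy
    simpa using hy
  | succ n ih =>
    by_cases hι : Function.Surjective ι.toOrderHom
    · have := SimplexCategory.epi_iff_surjective.mpr hι
      obtain rfl : Γ = ⦋n + 1⦌ := by
        ext
        exact le_antisymm (SimplexCategory.len_le_of_mono ι) (SimplexCategory.len_le_of_epi ι)
      obtain rfl := SimplexCategory.eq_id_of_mono ι
      intro y hy
      simpa using hy
    · obtain ⟨i, ι', rfl⟩ := SimplexCategory.eq_comp_δ_of_not_surjective ι hι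
      have := mono_of_mono ι' (SimplexCategory.δ i)
      have h := (ih ι' (S.δ i x)).comp (hc n x i)
      rw [op_comp, Functor.map_comp]
      exact h

/-- The sets `t.top`, for all systems `t` on `⦋n⦌`, cover `S_n`. -/
lemma exists_mem_top (hB : IsCoveringBasis S B) {Δ : SimplexCategory} (x : S.obj (op Δ)) :
    ∃ t : SetSystem S B Δ, x ∈ t.top := by
  obtain ⟨c, hcB, hcx, hc⟩ := hB.exists_nhd
  -- A nondegenerate simplex `ι` gets the neighbourhood of the face `S.map ι.op x`, and a degenerate
  -- one gets the image of the set attached to its nondegenerate part.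
  let t ⦃Γ : SimplexCategory⦄ (θ : Γ ⟶ Δ) : Set (S.obj (op Γ)) :=
    S.map (factorThruImage θ).op '' c (image θ).len (S.map (image.ι θ).op x)
  have ht {Γ Γ₁ : SimplexCategory} (e : Γ ⟶ Γ₁) (ι : Γ₁ ⟶ Δ) [Epi e] [Mono ι] :
      t (e ≫ ι) = S.map e.op '' c Γ₁.len (S.map ι.op x) := by
    obtain ⟨h, h₁, h₂⟩ := epi_mono_factorization_unique (factorThruImage (e ≫ ι))
      (image.ι (e ≫ ι)) e ι (image.fac _)
    simp only [t]
    generalize image.ι (e ≫ ι) = a, factorThruImage (e ≫ ι) = b at *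
    generalize image (e ≫ ι) = Γ₂ at *
    subst h
    simp only [eqToHom_refl, Category.comp_id, Category.id_comp] at h₁ h₂
    rw [h₁, h₂]
  have hepi ⦃Γ Γ' : SimplexCategory⦄ (φ : Γ' ⟶ Γ) [Epi φ] (θ : Γ ⟶ Δ) :
      t (φ ≫ θ) = S.map φ.op '' t θ := by
    conv_lhs => rw [← image.fac θ, ← Category.assoc]
    rw [ht, op_comp, Functor.map_comp, ← Set.image_comp]
    rfl
  refine ⟨⟨t, fun Γ θ ↦ hB.image_mem _ _ (hcB _ _), fun Γ Γ' φ θ ↦ ?_, hepi⟩, ?_⟩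
  · have key : Set.MapsTo (S.map (image.ι (φ ≫ factorThruImage θ)).op)
        (c (image θ).len (S.map (image.ι θ).op x))
        (c _ (S.map (image.ι (φ ≫ factorThruImage θ) ≫ image.ι θ).op x)) := by
      have := mapsTo_nhd_of_mono c hc _ (image.ι (φ ≫ factorThruImage θ)) (S.map (image.ι θ).op x)
      rw [op_comp, Functor.map_comp]
      exact this
    have h : φ ≫ θ = factorThruImage (φ ≫ factorThruImage θ) ≫
        (image.ι (φ ≫ factorThruImage θ) ≫ image.ι θ) := by
      rw [← Category.assoc, image.fac, Category.assoc, image.fac]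
    rw [h, ht]
    rintro _ ⟨y, hy, rfl⟩
    refine ⟨_, key hy, ?_⟩
    rw [← ConcreteCategory.comp_apply, ← ConcreteCategory.comp_apply, ← Functor.map_comp,
      ← Functor.map_comp, ← op_comp, ← op_comp, image.fac]
  · have := ht (𝟙 Δ) (𝟙 Δ)
    rw [Category.comp_id] at this
    change x ∈ t (𝟙 Δ)
    rw [this]
    exact ⟨x, by simpa using hcx _ _, by simp⟩

/-- A compatible family of systems on the proper faces of `⦋n + 1⦌` extends to a system on
`⦋n + 1⦌` whose top member is a neighbourhood of a given point with compatible faces. -/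
lemma exists_extension (hB : IsCoveringBasis S B) {n : ℕ}
    (t : ∀ ⦃Γ : SimplexCategory⦄, Γ.len ≤ n → (Γ ⟶ ⦋n + 1⦌) → SetSystem S B Γ)
    (ht : ∀ ⦃Γ Γ' : SimplexCategory⦄ (h : Γ.len ≤ n) (h' : Γ'.len ≤ n) (φ : Γ' ⟶ Γ)
      (θ : Γ ⟶ ⦋n + 1⦌), t h' (φ ≫ θ) = (t h θ).pullback φ)
    (x : S _⦋n + 1⦌)
    (hx : ∀ ⦃Γ : SimplexCategory⦄ (h : Γ.len ≤ n) (θ : Γ ⟶ ⦋n + 1⦌),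
      S.map θ.op x ∈ (t h θ).top) :
    ∃ t' : SetSystem S B ⦋n + 1⦌, x ∈ t'.top ∧
      ∀ ⦃Γ : SimplexCategory⦄ (h : Γ.len ≤ n) (θ : Γ ⟶ ⦋n + 1⦌), t'.pullback θ = t h θ := by
  classical
  have hlen : (⦋n⦌ : SimplexCategory).len ≤ n := le_rfl
  obtain ⟨W, hWB, hxW, hW⟩ := hB.exists_mem_succ n (fun i ↦ (t hlen (SimplexCategory.δ i)).top)
    (fun i ↦ (t hlen _).top_mem) x (fun i ↦ hx hlen (SimplexCategory.δ i))
  have hfac {Γ : SimplexCategory} (θ : Γ ⟶ ⦋n + 1⦌) (h : ¬ Epi θ) :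
      ∃ (i : Fin (n + 2)) (θ' : Γ ⟶ ⦋n⦌), θ = θ' ≫ SimplexCategory.δ i :=
    SimplexCategory.eq_comp_δ_of_not_surjective θ
      (fun h' ↦ h (SimplexCategory.epi_iff_surjective.mpr h'))
  -- The value at a simplex in the boundary does not depend on how it factors through a face:
  -- both factorizations are compared with the one through the image.
  have hwd {Γ Γ₁ : SimplexCategory} (h₁ : Γ₁.len ≤ n) (θ₁ : Γ ⟶ Γ₁) (ψ₁ : Γ₁ ⟶ ⦋n + 1⦌)
      (θ : Γ ⟶ ⦋n + 1⦌) (hθ : θ₁ ≫ ψ₁ = θ) :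
      ∃ h : (image θ).len ≤ n, (t h₁ ψ₁).set θ₁ = (t h (image.ι θ)).set (factorThruImage θ) := by
    subst hθ
    have hι : (image θ₁).len ≤ n :=
      (SimplexCategory.len_le_of_mono (image.ι θ₁)).trans h₁
    have hι' : (image (image.ι θ₁ ≫ ψ₁)).len ≤ n :=
      (SimplexCategory.len_le_of_epi (factorThruImage (image.ι θ₁ ≫ ψ₁))).trans hι
    obtain ⟨h, e₁, e₂⟩ := epi_mono_factorization_unique
      (factorThruImage θ₁ ≫ factorThruImage (image.ι θ₁ ≫ ψ₁)) (image.ι (image.ι θ₁ ≫ ψ₁))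
      (factorThruImage (θ₁ ≫ ψ₁)) (image.ι (θ₁ ≫ ψ₁))
      (by rw [Category.assoc, image.fac, image.fac, ← Category.assoc, image.fac])
    have e₃ : (t h₁ ψ₁).set θ₁ = (t hι' (image.ι (image.ι θ₁ ≫ ψ₁))).set
        (factorThruImage θ₁ ≫ factorThruImage (image.ι θ₁ ≫ ψ₁)) := by
      rw [← SetSystem.pullback_set, ← ht hι' hι, image.fac, ht h₁ hι, SetSystem.pullback_set,
        image.fac]
    rw [e₃]
    generalize image.ι (θ₁ ≫ ψ₁) = a, factorThruImage (θ₁ ≫ ψ₁) = b at *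
    generalize image (θ₁ ≫ ψ₁) = Γ₂ at *
    subst h
    simp only [eqToHom_refl, Category.comp_id, Category.id_comp] at e₁ e₂
    exact ⟨hι', by rw [e₁, e₂]⟩
  choose i ψ hψ using @hfac
  -- The values on the boundary are prescribed, and those on the degenerations of the top simplex are
  -- images of `W`.
  let s ⦃Γ : SimplexCategory⦄ (θ : Γ ⟶ ⦋n + 1⦌) : Set (S.obj (op Γ)) :=
    if h : Epi θ then S.map θ.op '' W else
      (t hlen (SimplexCategory.δ (i θ h))).set (ψ θ h)
  have hs_epi {Γ : SimplexCategory} (θ : Γ ⟶ ⦋n + 1⦌) [h : Epi θ] : s θ = S.map θ.op '' W :=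
    dif_pos h
  have hs {Γ Γ₁ : SimplexCategory} (h₁ : Γ₁.len ≤ n) (θ₁ : Γ ⟶ Γ₁) (ψ₁ : Γ₁ ⟶ ⦋n + 1⦌) :
      s (θ₁ ≫ ψ₁) = (t h₁ ψ₁).set θ₁ := by
    have hne : ¬ Epi (θ₁ ≫ ψ₁) := fun h ↦ by
      have := epi_of_epi θ₁ ψ₁
      have := SimplexCategory.len_le_of_epi ψ₁
      simp only at this
      lia
    obtain ⟨h, e⟩ := hwd h₁ θ₁ ψ₁ _ rfl
    obtain ⟨h', e'⟩ := hwd hlen (ψ _ hne) (SimplexCategory.δ (i _ hne)) _ (hψ _ hne).symm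
    rw [e]
    simp only [s, dif_neg hne]
    rw [e']
  have hs_epi_comp ⦃Γ Γ' : SimplexCategory⦄ (φ : Γ' ⟶ Γ) [Epi φ] (θ : Γ ⟶ ⦋n + 1⦌) :
      s (φ ≫ θ) = S.map φ.op '' s θ := by
    by_cases h : Epi θ
    · rw [hs_epi, hs_epi, op_comp, Functor.map_comp, ← Set.image_comp]; rfl
    · obtain ⟨i, θ', rfl⟩ : ∃ (i : Fin (n + 2)) (θ' : Γ ⟶ ⦋n⦌), θ = θ' ≫ SimplexCategory.δ i :=
        ⟨_, _, hψ θ h⟩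
      rw [← Category.assoc, hs hlen, hs hlen, SetSystem.set_comp_of_epi]
  refine ⟨⟨s, fun Γ θ ↦ ?_, fun Γ Γ' φ θ ↦ ?_, hs_epi_comp⟩, ?_, fun Γ h θ ↦ ?_⟩
  · by_cases h : Epi θ
    · rw [hs_epi]; exact hB.image_mem _ _ hWB
    · rw [hψ θ h, hs hlen]; exact SetSystem.set_mem _ _
  · by_cases h : Epi θ
    · rw [hs_epi]
      rintro _ ⟨y, hy, rfl⟩
      rw [← ConcreteCategory.comp_apply, ← Functor.map_comp, ← op_comp]
      by_cases h' : Epi (φ ≫ θ)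
      · rw [hs_epi]; exact ⟨y, hy, rfl⟩
      · rw [hψ _ h', hs hlen, op_comp, Functor.map_comp, ConcreteCategory.comp_apply]
        have := (t hlen (SimplexCategory.δ (i _ h'))).mapsTo_top (ψ _ h') (hW (i _ h') hy)
        rw [SetSystem.top, SetSystem.pullback_set, Category.id_comp] at this
        exact this
    · rw [hψ θ h, ← Category.assoc, hs hlen, hs hlen]
      exact SetSystem.mapsTo _ _ _
  · change x ∈ s (𝟙 _)
    rw [hs_epi]
    exact ⟨x, hxW, by simp⟩
  · ext Γ' θ' : 3
    exact hs h θ' θ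

end IsCoveringBasis

/-! ### Projections from the coskeleton -/

section Coskeleton

variable {C : Type*} [Category* C] [HasFiniteLimits C] {n : ℕ}

/-- The canonical morphism `cosk_n(Y)_Γ ⟶ Y_Γ` in dimensions at most `n`. -/
noncomputable def coskCounit (Y : SimplicialObject C) {Γ : SimplexCategory} (h : Γ.len ≤ n) :
    ((SimplicialObject.cosk n).obj Y).obj (op Γ) ⟶ Y.obj (op Γ) :=
  ((SimplexCategory.Truncated.inclusion n).op.ranCounit.app
    ((SimplicialObject.truncation n).obj Y)).app (op ⟨Γ, h⟩)

lemma toCosk_coskCounit (Y : SimplicialObject C) {Γ : SimplexCategory} (h : Γ.len ≤ n) :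
    (toCosk n Y).app (op Γ) ≫ coskCounit Y h = 𝟙 (Y.obj (op Γ)) :=
  (SimplexCategory.Truncated.inclusion n).op.ranCounit_app_app_ranAdjunction_unit_app_app
    Y (op ⟨Γ, h⟩)

lemma coskCounit_map (Y : SimplicialObject C) {Γ Γ' : SimplexCategory} (h : Γ.len ≤ n)
    (h' : Γ'.len ≤ n) (φ : Γ' ⟶ Γ) :
    coskCounit Y h ≫ Y.map φ.op =
      ((SimplicialObject.cosk n).obj Y).map φ.op ≫ coskCounit Y h' := by
  let φ' : (⟨Γ', h'⟩ : SimplexCategory.Truncated n) ⟶ ⟨Γ, h⟩ := ObjectProperty.homMk φ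
  exact (((SimplexCategory.Truncated.inclusion n).op.ranCounit.app
    ((SimplicialObject.truncation n).obj Y)).naturality φ'.op).symm

lemma cosk_map_coskCounit {V Y : SimplicialObject C} (f : V ⟶ Y) {Γ : SimplexCategory}
    (h : Γ.len ≤ n) :
    ((SimplicialObject.cosk n).map f).app (op Γ) ≫ coskCounit Y h =
      coskCounit V h ≫ f.app (op Γ) :=
  congrArg (fun α ↦ α.app (op ⟨Γ, h⟩))
    ((SimplexCategory.Truncated.inclusion n).op.ranCounit.naturality
      ((SimplicialObject.truncation n).map f))

/-- The projection `cosk_n(Y)_Δ ⟶ Y_Γ` attached to a simplex `θ : Γ ⟶ Δ` of dimension at most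
`n`. The coskeleton is the limit of the `Y_Γ` along these projections. -/
noncomputable def coskProj (Y : SimplicialObject C) {Γ Δ : SimplexCategory} (h : Γ.len ≤ n)
    (θ : Γ ⟶ Δ) : ((SimplicialObject.cosk n).obj Y).obj (op Δ) ⟶ Y.obj (op Γ) :=
  ((SimplicialObject.cosk n).obj Y).map θ.op ≫ coskCounit Y h

lemma toCosk_coskProj (Y : SimplicialObject C) {Γ Δ : SimplexCategory} (h : Γ.len ≤ n)
    (θ : Γ ⟶ Δ) : (toCosk n Y).app (op Δ) ≫ coskProj Y h θ = Y.map θ.op := by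
  rw [coskProj, ← NatTrans.naturality_assoc, toCosk_coskCounit, Category.comp_id]

lemma coskProj_map (Y : SimplicialObject C) {Γ Γ' Δ : SimplexCategory} (h : Γ.len ≤ n)
    (h' : Γ'.len ≤ n) (φ : Γ' ⟶ Γ) (θ : Γ ⟶ Δ) :
    coskProj Y h θ ≫ Y.map φ.op = coskProj Y h' (φ ≫ θ) := by
  rw [coskProj, coskProj, op_comp, Functor.map_comp, Category.assoc, Category.assoc,
    coskCounit_map Y h h']

lemma cosk_map_coskProj {V Y : SimplicialObject C} (f : V ⟶ Y) {Γ Δ : SimplexCategory}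
    (h : Γ.len ≤ n) (θ : Γ ⟶ Δ) :
    ((SimplicialObject.cosk n).map f).app (op Δ) ≫ coskProj Y h θ =
      coskProj V h θ ≫ f.app (op Γ) := by
  rw [coskProj, coskProj, ← NatTrans.naturality_assoc, cosk_map_coskCounit, Category.assoc]

lemma cosk_hom_ext (Y : SimplicialObject C) {Δ : SimplexCategory} {T : C}
    {a b : T ⟶ ((SimplicialObject.cosk n).obj Y).obj (op Δ)}
    (hab : ∀ ⦃Γ : SimplexCategory⦄ (h : Γ.len ≤ n) (θ : Γ ⟶ Δ),
      a ≫ coskProj Y h θ = b ≫ coskProj Y h θ) : a = b :=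
  ((SimplexCategory.Truncated.inclusion n).op.isPointwiseRightKanExtensionRanCounit
    ((SimplicialObject.truncation n).obj Y) (op Δ)).hom_ext
      fun j ↦ hab j.right.unop.property j.hom.unop

lemma toRelativeCosk_fst {V Y : SimplicialObject C} (f : V ⟶ Y) (n : ℕ) :
    toRelativeCosk f n ≫ pullback.fst _ _ = (toCosk n V).app (op ⦋n + 1⦌) :=
  pullback.lift_fst _ _ _

lemma toRelativeCosk_snd {V Y : SimplicialObject C} (f : V ⟶ Y) (n : ℕ) :
    toRelativeCosk f n ≫ pullback.snd _ _ = f.app (op ⦋n + 1⦌) :=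
  pullback.lift_snd _ _ _

end Coskeleton

/-! ### Étale schemes over the base -/

section Etale

variable {X : Scheme.{u}}

lemma etale_left {A B : Over X} (f : A ⟶ B) [Etale A.hom] [Etale B.hom] : Etale f.left :=
  MorphismProperty.of_postcomp @Etale (W' := @Etale) f.left B.hom ‹_› (by
    rw [Over.w]; infer_instance)

/-- A finite limit of étale `X`-schemes is étale over `X`. -/
lemma etale_hom_of_isLimit {J : Type*} [SmallCategory J] [FinCategory J] {F : J ⥤ Over X}
    (hF : ∀ j, Etale (F.obj j).hom) {c : Cone F} (hc : IsLimit c) : Etale c.pt.hom := by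
  let F' : J ⥤ X.Etale :=
    { obj j := have := hF j; Scheme.Etale.mk (F.obj j).hom
      map {i j} a := (Scheme.Etale.forgetFullyFaithful X).preimage (F.map a)
      map_id j := (Scheme.Etale.forget X).map_injective (F.map_id j)
      map_comp a b := (Scheme.Etale.forget X).map_injective (F.map_comp a b) }
  let c' := (Scheme.Etale.forget X).mapCone (limit.cone F')
  have hc' : IsLimit c' := isLimitOfPreserves _ (limit.isLimit F')
  let e : c.pt ≅ (Scheme.Etale.forget X).obj (limit F') := hc.conePointUniqueUpToIso hc'
  rw [← Over.w e.hom]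
  have : Etale ((Scheme.Etale.forget X).obj (limit F')).hom := (limit F').prop
  have : IsIso e.hom.left := (Over.forget X).map_isIso e.hom
  exact Etale.etale_comp e.hom.left _

/-- The coskeleton of a simplicial `X`-scheme that is étale over `X` in degrees at most `n`. -/
lemma etale_cosk (Y : SimplicialObject (Over X)) (n : ℕ)
    (hY : ∀ m ≤ n, Etale (Y _⦋m⦌).hom) (Δ : SimplexCategory) :
    Etale (((SimplicialObject.cosk n).obj Y).obj (op Δ)).hom :=
  etale_hom_of_isLimit (F := StructuredArrow.proj (op Δ) (SimplexCategory.Truncated.inclusion n).op ⋙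
      (SimplicialObject.truncation n).obj Y) (fun j ↦ hY _ j.right.unop.property)
    ((SimplexCategory.Truncated.inclusion n).op.isPointwiseRightKanExtensionRanCounit
      ((SimplicialObject.truncation n).obj Y) (op Δ))

lemma etale_pullback {A B S : Over X} (f : A ⟶ S) (g : B ⟶ S) [Etale A.hom] [Etale B.hom]
    [Etale S.hom] : Etale (pullback f g).hom := by
  have := etale_left g
  have h := (IsPullback.of_hasPullback f g).map (Over.forget X)
  have : Etale (pullback.fst f g).left :=
    MorphismProperty.of_isPullback (P := @Etale) h.flip ‹_›
  rw [← Over.w (pullback.fst f g)]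
  infer_instance

/-- All schemes in an étale hypercovering of `X` are étale over `X`. -/
lemma IsEtaleHypercovering.etale {Y : SimplicialObject (Over X)} (hY : IsEtaleHypercovering Y)
    (n : ℕ) : Etale (Y _⦋n⦌).hom := by
  induction n using Nat.strong_induction_on with
  | _ n ih =>
    cases n with
    | zero => exact hY.etale_zero
    | succ n =>
      have := etale_cosk Y n (fun m hm ↦ ih m (Nat.lt_succ_of_le hm)) ⦋n + 1⦌
      have := hY.etale_succ n
      rw [← Over.w ((toCosk n Y).app (op ⦋n + 1⦌))]
      infer_instance

/-- A section of an étale morphism is an open immersion. -/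
lemma isOpenImmersion_of_section {A B : Scheme.{u}} (i : A ⟶ B) (p : B ⟶ A) [Etale p]
    (h : i ≫ p = 𝟙 A) : IsOpenImmersion i := by
  have : MorphismProperty.HasOfPostcompProperty @IsOpenImmersion.{u} @Etale.{u} :=
    MorphismProperty.hasOfPostcompProperty_iff_le_diagonal.mpr fun _ _ f (_ : Etale f) ↦
      inferInstanceAs (IsOpenImmersion (pullback.diagonal f))
  exact MorphismProperty.of_postcomp @IsOpenImmersion (W' := @Etale) i p ‹_› (by
    rw [h]; infer_instance)

end Etale
/-! ### Coverings by standard smooth open subschemes -/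

lemma IsStandardSmoothScheme.of_iso {k : Type u} [CommRing k] {U U' : Scheme.{u}}
    {s : U ⟶ Spec (CommRingCat.of k)} {s' : U' ⟶ Spec (CommRingCat.of k)}
    (h : IsStandardSmoothScheme k U s) (e : U' ≅ U) (he : e.hom ≫ s = s') :
    IsStandardSmoothScheme k U' s' := by
  obtain ⟨A, _, _, hA, e', he'⟩ := h
  exact ⟨A, _, _, hA, e ≪≫ e', by rw [Iso.trans_hom, Category.assoc, he', he]⟩

lemma IsStandardSmoothScheme.isAffine {k : Type u} [CommRing k] {U : Scheme.{u}}
    {s : U ⟶ Spec (CommRingCat.of k)} (h : IsStandardSmoothScheme k U s) : IsAffine U := by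
  obtain ⟨A, _, _, hA, e, he⟩ := h
  exact .of_isIso e.hom

section

variable {k : Type u} [Field k] {T : Scheme.{u}} (g : T ⟶ Spec (CommRingCat.of k))

/-- The subsets of a `k`-scheme that underlie a standard smooth open subscheme. -/
def IsStandardSmoothOpen (V : Set T) : Prop :=
  ∃ U : T.Opens, (U : Set T) = V ∧ IsStandardSmoothScheme k U.toScheme (U.ι ≫ g)

lemma IsStandardSmoothOpen.image {T' : Scheme.{u}} {g' : T' ⟶ Spec (CommRingCat.of k)}
    (i : T ⟶ T') [IsOpenImmersion i] (hi : i ≫ g' = g) {V : Set T}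
    (hV : IsStandardSmoothOpen g V) : IsStandardSmoothOpen g' (i '' V) := by
  obtain ⟨U, rfl, hU⟩ := hV
  refine ⟨i ''ᵁ U, rfl, hU.of_iso (i.isoImage U).symm ?_⟩
  rw [← hi, Iso.symm_hom, ← Category.assoc, ← Category.assoc, Category.assoc _ _ i,
    Scheme.Hom.isoImage_inv_ι]

/-- A smooth scheme over a field has a basis of standard smooth open subschemes. -/
lemma exists_isStandardSmoothScheme [Smooth g] (W : T.Opens) (x : T) (hx : x ∈ W) :
    ∃ V : T.Opens, x ∈ V ∧ V ≤ W ∧ IsStandardSmoothScheme k V.toScheme (V.ι ≫ g) := by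
  obtain ⟨U, hU, V₀, hV₀, hxV₀, e, he⟩ := Smooth.exists_isStandardSmooth g x
  -- The spectrum of a field has only one point.
  obtain rfl : U = ⊤ := by
    ext y
    simpa [Subsingleton.elim y (g x)] using e hxV₀
  obtain ⟨f, hfW, hxf⟩ := hV₀.exists_basicOpen_le ⟨x, hx⟩ hxV₀
  have hV := hV₀.basicOpen f
  have hle : T.basicOpen f ≤ V₀ := T.basicOpen_le f
  refine ⟨T.basicOpen f, hxf, hfW, ?_⟩
  have h₁ : (T.presheaf.map (homOfLE hle).op).hom.IsStandardSmooth := by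
    have := hV₀.isLocalization_basicOpen f
    exact RingHom.isStandardSmooth_holdsForLocalizationAway _ f
  let φ : CommRingCat.of k ⟶ Γ(T, T.basicOpen f) :=
    (Scheme.ΓSpecIso (CommRingCat.of k)).inv ≫ g.appLE ⊤ (T.basicOpen f) (hle.trans e)
  have h₂ : φ.hom.IsStandardSmooth := by
    have h₃ : (g.appLE ⊤ (T.basicOpen f) (hle.trans e)).hom.IsStandardSmooth := by
      rw [← Scheme.Hom.appLE_map g e (homOfLE hle).op]
      exact h₁.comp he
    exact RingHom.isStandardSmooth_respectsIso.2 _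
      (Scheme.ΓSpecIso (CommRingCat.of k)).symm.commRingCatIsoToRingEquiv h₃
  let := φ.hom.toAlgebra
  refine ⟨Γ(T, T.basicOpen f), inferInstance, inferInstance, h₂, hV.isoSpec, ?_⟩
  change (T.basicOpen f).toSpecΓ ≫ Spec.map φ = _
  rw [Spec.map_comp, Scheme.Opens.toSpecΓ_SpecMap_appLE_assoc, Scheme.Opens.toSpecΓ_top,
    Category.assoc, Scheme.Hom.resLE_comp_ι_assoc,
    show (Spec (CommRingCat.of k)).toSpecΓ = Spec.map (Scheme.ΓSpecIso (CommRingCat.of k)).hom from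
      Scheme.isoSpec_Spec_hom _, ← Spec.map_comp, Iso.inv_hom_id, Spec.map_id, Category.comp_id]

/-- Every open subset of a quasi-compact smooth scheme over a field is covered by finitely many
standard smooth open subschemes, because the scheme is noetherian. -/
lemma exists_finite_isStandardSmoothOpen [Smooth g] [CompactSpace T] (W : Set T) (hW : IsOpen W) :
    ∃ B : Set (Set T), B.Finite ∧ (∀ V ∈ B, V ⊆ W ∧ IsStandardSmoothOpen g V) ∧
      ∀ x ∈ W, ∃ V ∈ B, x ∈ V := by
  have : IsNoetherian T := { __ := LocallyOfFiniteType.isLocallyNoetherian g }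
  choose V hxV hVW hV using fun x : W ↦ exists_isStandardSmoothScheme g ⟨W, hW⟩ x x.2
  obtain ⟨t, ht⟩ := (TopologicalSpace.NoetherianSpace.isCompact W).elim_finite_subcover
    (fun x : W ↦ (V x : Set T)) (fun x ↦ (V x).isOpen)
    (fun x hx ↦ Set.mem_iUnion.mpr ⟨⟨x, hx⟩, hxV _⟩)
  refine ⟨(fun x ↦ (V x : Set T)) '' t, t.finite_toSet.image _, ?_, fun x hx ↦ ?_⟩
  · rintro _ ⟨x, -, rfl⟩
    exact ⟨hVW x, V x, rfl, hV x⟩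
  · obtain ⟨y, hy, hxy⟩ := Set.mem_iUnion₂.mp (ht hx)
    exact ⟨_, ⟨y, hy, rfl⟩, hxy⟩

end

/-! ### A covering basis of standard smooth open subschemes -/

section

variable {X : Scheme.{u}}

/-- The simplicial set of points of a simplicial `X`-scheme. -/
def points (Z : SimplicialObject (Over X)) : SSet.{u} where
  obj Δ := (Z.obj Δ).left
  map f := ↾ (Z.map f).left
  map_id Δ := by ext x; simp
  map_comp f g := by ext x; simp

/-- A degeneracy of a simplicial scheme that is étale over `X` is a section of a morphism between
étale `X`-schemes, hence an open immersion. -/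
lemma isOpenImmersion_map_left (Z : SimplicialObject (Over X))
    (hZ : ∀ n : ℕ, Etale (Z _⦋n⦌).hom) {Γ Γ' : SimplexCategory} (φ : Γ' ⟶ Γ) [Epi φ] :
    IsOpenImmersion (Z.map φ.op).left := by
  have : IsSplitEpi φ := isSplitEpi_of_epi φ
  have := hZ Γ.len
  have := hZ Γ'.len
  have := etale_left (A := Z.obj (op Γ')) (B := Z.obj (op Γ)) (Z.map (section_ φ).op)
  refine isOpenImmersion_of_section _ (Z.map (section_ φ).op).left ?_
  rw [← Over.comp_left, ← Functor.map_comp, ← op_comp, IsSplitEpi.id]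
  simp

variable {k : Type u} [Field k] (s : X ⟶ Spec (CommRingCat.of k))

/-- The covering basis is constructed by recursion on the degree: in degree `n + 1` it consists of
the images of the members of degree `n` under the degeneracies, and of the members of finite
coverings of the intersections of inverse images under the faces of members of degree `n`. -/
lemma exists_isCoveringBasis (Z : SimplicialObject (Over X))
    (hZ : ∀ n : ℕ, Etale (Z _⦋n⦌).hom) (hs : ∀ n : ℕ, Smooth ((Z _⦋n⦌).hom ≫ s))
    (hc : ∀ n : ℕ, CompactSpace (Z _⦋n⦌).left) :
    ∃ B : ∀ Γ : SimplexCategory, Set (Set ((points Z).obj (op Γ))),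
      IsCoveringBasis (points Z) B ∧
      ∀ Γ, ∀ V ∈ B Γ, IsStandardSmoothOpen ((Z.obj (op Γ)).hom ≫ s) V := by
  let P (n : ℕ) : Type u := {b : Set (Set ((points Z) _⦋n⦌)) //
    b.Finite ∧ ∀ V ∈ b, IsStandardSmoothOpen ((Z _⦋n⦌).hom ≫ s) V}
  have step (n : ℕ) (b : P n) : ∃ b' : P (n + 1),
      (∀ (i : Fin (n + 1)), ∀ V ∈ b.1, (points Z).σ i '' V ∈ b'.1) ∧
      ∀ (V : Fin (n + 2) → Set ((points Z) _⦋n⦌)) (_ : ∀ i, V i ∈ b.1) (x : (points Z) _⦋n + 1⦌)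
        (_ : ∀ i, (points Z).δ i x ∈ V i),
        ∃ W ∈ b'.1, x ∈ W ∧ ∀ i, Set.MapsTo ((points Z).δ i) W (V i) := by
    obtain ⟨b, hbf, hb⟩ := b
    have := hs (n + 1)
    have := hc (n + 1)
    have hopen (V : Fin (n + 2) → b) :
        IsOpen (⋂ i, (Z.δ i).left ⁻¹' (V i).1 : Set (Z _⦋n + 1⦌).left) := by
      refine isOpen_iInter_of_finite fun i ↦ ?_
      obtain ⟨U, hU, -⟩ := hb _ (V i).2
      rw [← hU]
      exact U.isOpen.preimage (Z.δ i).left.continuous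
    choose c hcf hcW hc using fun V ↦ exists_finite_isStandardSmoothOpen
      ((Z _⦋n + 1⦌).hom ≫ s) _ (hopen V)
    have : Finite b := hbf
    refine ⟨⟨(⋃ i : Fin (n + 1), (fun V ↦ (points Z).σ i '' V) '' b) ∪ ⋃ V, c V,
      (Set.finite_iUnion fun i ↦ hbf.image _).union (Set.finite_iUnion hcf), ?_⟩, ?_, ?_⟩
    · rintro _ (h | h)
      · obtain ⟨i, V, hV, rfl⟩ := Set.mem_iUnion.mp h
        have : IsOpenImmersion (Z.σ i).left :=
          isOpenImmersion_map_left Z hZ (SimplexCategory.σ i)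
        exact (hb V hV).image _ (g' := (Z _⦋n + 1⦌).hom ≫ s) (Z.σ i).left (by simp)
      · obtain ⟨V, hV⟩ := Set.mem_iUnion.mp h
        exact (hcW V _ hV).2
    · exact fun i V hV ↦ Or.inl (Set.mem_iUnion.mpr ⟨i, V, hV, rfl⟩)
    · intro V hV x hx
      obtain ⟨W, hW, hxW⟩ := hc (fun i ↦ ⟨V i, hV i⟩) x (Set.mem_iInter.mpr hx)
      exact ⟨W, Or.inr (Set.mem_iUnion.mpr ⟨_, hW⟩), hxW,
        fun i y hy ↦ Set.mem_iInter.mp ((hcW _ W hW).1 hy) i⟩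
  have := hs 0
  have := hc 0
  obtain ⟨b₀, hb₀f, hb₀, hb₀c⟩ := exists_finite_isStandardSmoothOpen
    ((Z _⦋0⦌).hom ≫ s) Set.univ isOpen_univ
  choose F hFσ hFδ using step
  let b : ∀ n : ℕ, P n := fun n ↦ Nat.rec ⟨b₀, hb₀f, fun V hV ↦ (hb₀ V hV).2⟩ F n
  refine ⟨fun Γ ↦ (b Γ.len).1, ⟨fun Γ ↦ (b Γ.len).2.1, fun x ↦ hb₀c x trivial, ?_,
    fun n V hV x hx ↦ hFδ n (b n) V hV x hx⟩, fun Γ ↦ (b Γ.len).2.2⟩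
  -- Every epimorphism of the simplex category is a composition of degeneracies.
  suffices ∀ (m : ℕ) (Γ : SimplexCategory) (φ : ⦋m⦌ ⟶ Γ) [Epi φ] (V : Set ((points Z).obj (op Γ))),
      V ∈ (b Γ.len).1 → (points Z).map φ.op '' V ∈ (b m).1 from
    fun {Γ Γ'} φ _ V hV ↦ this Γ'.len Γ φ V hV
  intro m
  induction m with
  | zero =>
    intro Γ φ _ V hV
    obtain rfl : ⦋0⦌ = Γ := by
      ext; exact ((SimplexCategory.len_le_of_epi φ).antisymm (Nat.zero_le _)).symm
    obtain rfl := SimplexCategory.eq_id_of_epi φ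
    simpa using hV
  | succ m ih =>
    intro Γ φ _ V hV
    by_cases hφ : Function.Injective φ.toOrderHom
    · have := SimplexCategory.mono_iff_injective.mpr hφ
      obtain rfl : ⦋m + 1⦌ = Γ := by
        ext
        exact le_antisymm (SimplexCategory.len_le_of_mono φ) (SimplexCategory.len_le_of_epi φ)
      obtain rfl := SimplexCategory.eq_id_of_epi φ
      simpa using hV
    · obtain ⟨i, φ', rfl⟩ := SimplexCategory.eq_σ_comp_of_not_injective φ hφ
      have := epi_of_epi (SimplexCategory.σ i) φ'
      have := hFσ m (b m) i _ (ih Γ φ' V hV)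
      rw [← Set.image_comp] at this
      rw [op_comp, Functor.map_comp]
      exact this

end

/-! ### The simplicial scheme attached to a covering basis -/

/-- Surjectivity can be tested on points with values in the residue fields of the target. -/
lemma surjective_of_forall_exists_lift {A B : Scheme.{u}} (g : A ⟶ B)
    (h : ∀ (K : Type u) [Field K] (q : Spec (CommRingCat.of K) ⟶ B), ∃ q', q' ≫ g = q) :
    Surjective g := by
  refine ⟨fun x ↦ ?_⟩
  obtain ⟨q', hq'⟩ := h (B.residueField x) (B.fromSpecResidueField x)
  refine ⟨q' (IsLocalRing.closedPoint _), ?_⟩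
  exact (congrArg (fun a ↦ a (IsLocalRing.closedPoint _)) hq').trans
    (B.fromSpecResidueField_apply x _)

lemma comp_ι_mem {A T : Scheme.{u}} (U : A.Opens) (q : T ⟶ U.toScheme) (y : T) :
    (q ≫ U.ι) y ∈ U :=
  (q y).2

lemma ι_mem {A : Scheme.{u}} (U : A.Opens) (y : U.toScheme) : U.ι y ∈ U :=
  y.2

variable {X : Scheme.{u}} {Z : SimplicialObject (Over X)}
  {B : ∀ Γ : SimplexCategory, Set (Set ((points Z).obj (op Γ)))}

/-- The members of `B` are open subsets of the schemes `Z_Γ`. -/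
def HasOpenMembers (B : ∀ Γ : SimplexCategory, Set (Set ((points Z).obj (op Γ)))) : Prop :=
  ∀ Γ, ∀ V ∈ B Γ, IsOpen (X := (Z.obj (op Γ)).left) V

namespace HasOpenMembers

variable (hB : HasOpenMembers B)

/-- The open subscheme of `Z_Δ` given by the top member of a system. -/
def opens {Δ : SimplexCategoryᵒᵖ} (t : SetSystem (points Z) B Δ.unop) : (Z.obj Δ).left.Opens :=
  ⟨t.top, hB _ _ t.top_mem⟩

/-- The disjoint union of the top members of all systems on `Δ`. -/
noncomputable def union (Δ : SimplexCategoryᵒᵖ) : Scheme.{u} :=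
  ∐ fun t : SetSystem (points Z) B Δ.unop ↦ (hB.opens t).toScheme

/-- The inclusion of a summand of the disjoint union. -/
noncomputable def incl {Δ : SimplexCategoryᵒᵖ} (t : SetSystem (points Z) B Δ.unop) :
    (hB.opens t).toScheme ⟶ hB.union Δ :=
  Sigma.ι (fun t : SetSystem (points Z) B Δ.unop ↦ (hB.opens t).toScheme) t

/-- The morphism from the disjoint union to a scheme `A` given by a family of morphisms. -/
noncomputable def desc {Δ : SimplexCategoryᵒᵖ} {A : Scheme.{u}}
    (a : ∀ t : SetSystem (points Z) B Δ.unop, (hB.opens t).toScheme ⟶ A) : hB.union Δ ⟶ A :=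
  Sigma.desc a

section

variable {Δ : SimplexCategoryᵒᵖ} (t : SetSystem (points Z) B Δ.unop)

instance : IsOpenImmersion (hB.incl t) :=
  inferInstanceAs (IsOpenImmersion (Sigma.ι _ _))

lemma incl_desc {A : Scheme.{u}}
    (a : ∀ t : SetSystem (points Z) B Δ.unop, (hB.opens t).toScheme ⟶ A) :
    hB.incl t ≫ hB.desc a = a t :=
  Sigma.ι_desc _ _

lemma hom_ext {A : Scheme.{u}} {a b : hB.union Δ ⟶ A}
    (h : ∀ t : SetSystem (points Z) B Δ.unop, hB.incl t ≫ a = hB.incl t ≫ b) : a = b :=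
  Sigma.hom_ext _ _ h

variable (Δ) in
/-- The morphism to `Z_Δ` that is the inclusion on each summand. -/
noncomputable def toZ : hB.union Δ ⟶ (Z.obj Δ).left := hB.desc fun t ↦ (hB.opens t).ι

/-- The morphism to the disjoint union that is given by a system `t` and a morphism to `Z_Δ` with
image in the top member of `t`. -/
noncomputable def lift {T : Scheme.{u}} (p : T ⟶ (Z.obj Δ).left) (hp : ∀ y, p y ∈ hB.opens t) :
    T ⟶ hB.union Δ :=
  IsOpenImmersion.lift (hB.opens t).ι p
    (by rw [Scheme.Opens.range_ι]; rintro _ ⟨y, rfl⟩; exact hp y) ≫ hB.incl t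

variable {t} {T : Scheme.{u}} {p : T ⟶ (Z.obj Δ).left} (hp : ∀ y, p y ∈ hB.opens t)

lemma lift_toZ : hB.lift t p hp ≫ hB.toZ Δ = p := by
  rw [lift, toZ, Category.assoc, incl_desc, IsOpenImmersion.lift_fac]

lemma lift_congr {t' : SetSystem (points Z) B Δ.unop} {p' : T ⟶ (Z.obj Δ).left}
    (ht : t = t') (hpp' : p = p') (hp' : ∀ y, p' y ∈ hB.opens t') :
    hB.lift t p hp = hB.lift t' p' hp' := by
  subst ht hpp'
  rfl

lemma comp_incl (q : T ⟶ (hB.opens t).toScheme) :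
    q ≫ hB.incl t = hB.lift t (q ≫ (hB.opens t).ι) (comp_ι_mem _ q) := by
  rw [lift]
  congr 1
  simp [← cancel_mono (hB.opens t).ι]

lemma incl_eq_lift (t : SetSystem (points Z) B Δ.unop) :
    hB.incl t = hB.lift t (hB.opens t).ι (ι_mem _) := by
  refine ((Category.id_comp (hB.incl t)).symm.trans (hB.comp_incl _)).trans ?_
  exact hB.lift_congr _ rfl (Category.id_comp _) _

lemma comp_lift {T' : Scheme.{u}} (q : T' ⟶ T) :
    q ≫ hB.lift t p hp = hB.lift t (q ≫ p)
      (fun y ↦ by rw [Scheme.Hom.comp_apply]; exact hp (q y)) := by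
  rw [lift, ← Category.assoc, comp_incl]
  simp only [Category.assoc, IsOpenImmersion.lift_fac]

/-- The summand that contains the image of a morphism from a nonempty scheme is unique. -/
lemma eq_of_lift_eq_lift [Nonempty T] {t' : SetSystem (points Z) B Δ.unop}
    {p' : T ⟶ (Z.obj Δ).left} {hp' : ∀ y, p' y ∈ hB.opens t'}
    (h : hB.lift t p hp = hB.lift t' p' hp') : t = t' := by
  by_contra hne
  exact (isEmpty_of_commSq_sigmaι_of_ne ⟨h⟩ hne).false (Classical.arbitrary T)

/-- A point of the disjoint union with values in a field lies in one of the summands. -/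
lemma exists_eq_lift {K : Type u} [Field K] (q : Spec (CommRingCat.of K) ⟶ hB.union Δ) :
    ∃ (t : SetSystem (points Z) B Δ.unop) (h : ∀ y, (q ≫ hB.toZ Δ) y ∈ hB.opens t),
      q = hB.lift t (q ≫ hB.toZ Δ) h := by
  let x₀ : Spec (CommRingCat.of K) := Classical.arbitrary _
  obtain ⟨t, y, hy⟩ : ∃ (t : SetSystem (points Z) B Δ.unop) (y : hB.opens t),
      hB.incl t y = q x₀ :=
    ⟨_, (sigmaOpenCover (fun t : SetSystem (points Z) B Δ.unop ↦
      (hB.opens t).toScheme)).covers (q x₀)⟩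
  let q' := IsOpenImmersion.lift (hB.incl t) q (by
      rintro _ ⟨x, rfl⟩
      exact ⟨y, by rw [hy, Subsingleton.elim x x₀]⟩)
  have hq : q' ≫ hB.incl t = q := IsOpenImmersion.lift_fac _ _ _
  have hq' : q ≫ hB.toZ Δ = q' ≫ (hB.opens t).ι := by
    rw [← hq, Category.assoc, toZ, incl_desc]
  have hmem : ∀ y, (q ≫ hB.toZ Δ) y ∈ hB.opens t := by
    rw [hq']
    exact comp_ι_mem _ q'
  refine ⟨t, hmem, ?_⟩
  conv_lhs => rw [← hq]
  rw [comp_incl]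
  exact hB.lift_congr _ rfl hq'.symm _

end

section

variable {Δ Δ' : SimplexCategoryᵒᵖ} (f : Δ ⟶ Δ')

lemma map_mem_opens (t : SetSystem (points Z) B Δ.unop) {T : Scheme.{u}}
    (p : T ⟶ (Z.obj Δ).left) (hp : ∀ y, p y ∈ hB.opens t) (y : T) :
    (p ≫ (Z.map f).left) y ∈ hB.opens (t.pullback f.unop) :=
  t.mapsTo_top f.unop (hp y)

/-- The simplicial operators of the disjoint unions: they restrict systems, and they are given by
the operators of `Z` on each summand. -/
noncomputable def unionMap : hB.union Δ ⟶ hB.union Δ' :=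
  hB.desc fun t ↦ hB.lift (t.pullback f.unop) ((hB.opens t).ι ≫ (Z.map f).left)
    (hB.map_mem_opens f t _ (ι_mem _))

lemma lift_unionMap {t : SetSystem (points Z) B Δ.unop} {T : Scheme.{u}}
    {p : T ⟶ (Z.obj Δ).left} (hp : ∀ y, p y ∈ hB.opens t) :
    hB.lift t p hp ≫ hB.unionMap f =
      hB.lift (t.pullback f.unop) (p ≫ (Z.map f).left) (hB.map_mem_opens f t p hp) := by
  rw [lift, unionMap, Category.assoc, incl_desc, comp_lift]
  exact hB.lift_congr _ rfl (by rw [IsOpenImmersion.lift_fac_assoc]) _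

lemma unionMap_toZ : hB.unionMap f ≫ hB.toZ Δ' = hB.toZ Δ ≫ (Z.map f).left := by
  refine hB.hom_ext fun t ↦ ?_
  rw [incl_eq_lift, ← Category.assoc, lift_unionMap, lift_toZ, ← Category.assoc, lift_toZ]

end

/-- The simplicial `X`-scheme of the disjoint unions of the top members of systems. -/
noncomputable def refinement : SimplicialObject (Over X) where
  obj Δ := Over.mk (hB.toZ Δ ≫ (Z.obj Δ).hom)
  map {Δ Δ'} f := Over.homMk (hB.unionMap f) (by
    simp only [Over.mk_left, Over.mk_hom]
    rw [← Category.assoc, unionMap_toZ, Category.assoc, Over.w])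
  map_id Δ := by
    refine Over.OverMorphism.ext (hB.hom_ext fun t ↦ ?_)
    simp only [Over.homMk_left, Over.id_left]
    refine (congrArg (· ≫ hB.unionMap (𝟙 Δ)) (hB.incl_eq_lift t)).trans ?_
    refine Eq.trans ?_ (Category.comp_id (hB.incl t)).symm
    rw [lift_unionMap, incl_eq_lift]
    exact hB.lift_congr _ t.pullback_id (by simp) _
  map_comp {Δ Δ' Δ''} f g := by
    refine Over.OverMorphism.ext ?_
    change hB.unionMap (f ≫ g) = hB.unionMap f ≫ hB.unionMap g
    refine hB.hom_ext fun t ↦ ?_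
    rw [incl_eq_lift, lift_unionMap, ← Category.assoc, lift_unionMap, lift_unionMap]
    exact hB.lift_congr _ (t.pullback_comp f.unop g.unop) (by simp) _

/-- The morphism to `Z` given by the inclusions of the top members. -/
noncomputable def refinementHom : hB.refinement ⟶ Z where
  app Δ := Over.homMk (hB.toZ Δ) rfl
  naturality _ _ f := Over.OverMorphism.ext (hB.unionMap_toZ f)

end HasOpenMembers

/-! ### The refinement -/

namespace HasOpenMembers

variable {X : Scheme.{u}} {Z : SimplicialObject (Over X)}
  {B : ∀ Γ : SimplexCategory, Set (Set ((points Z).obj (op Γ)))} (hB : HasOpenMembers B)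

instance etale_toZ (Δ : SimplexCategoryᵒᵖ) : Etale (hB.toZ Δ) :=
  have : IsZariskiLocalAtSource @Etale.{u} :=
    HasRingHomProperty.instIsZariskiLocalAtSource (P := @Etale.{u}) (Q := RingHom.Etale)
  IsZariskiLocalAtSource.sigmaDesc (P := @Etale.{u}) fun t ↦
    inferInstanceAs (Etale (hB.opens t).ι)

lemma surjective_toZ (hB' : IsCoveringBasis (points Z) B) (Δ : SimplexCategoryᵒᵖ) :
    Surjective (hB.toZ Δ) := by
  refine ⟨fun x ↦ ?_⟩
  obtain ⟨t, ht⟩ := hB'.exists_mem_top (Δ := Δ.unop) x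
  obtain ⟨y, hy⟩ : ∃ y : (hB.opens t).toScheme, (hB.opens t).ι y = x := ⟨⟨x, ht⟩, rfl⟩
  refine ⟨hB.incl t y, ?_⟩
  rw [← Scheme.Hom.comp_apply, toZ, incl_desc, hy]

lemma etale_refinement (hZ : ∀ n : ℕ, Etale (Z _⦋n⦌).hom) (n : ℕ) :
    Etale (hB.refinement _⦋n⦌).hom := by
  have := hZ n
  exact inferInstanceAs (Etale (hB.toZ (op ⦋n⦌) ≫ (Z _⦋n⦌).hom))

/-- A `K`-point of the relative coskeleton is a matching family of `K`-points of the disjoint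
unions together with a `K`-point of `Z_{n+1}`. Its components lie in the summands given by a
matching family of systems, which extends to a system with a suitable top member. -/
lemma surjective_toRelativeCosk (hB' : IsCoveringBasis (points Z) B) (n : ℕ) :
    Surjective (toRelativeCosk hB.refinementHom n).left := by
  refine surjective_of_forall_exists_lift _ fun K _ q ↦ ?_
  let P := pullback (((SimplicialObject.cosk n).map hB.refinementHom).app (op ⦋n + 1⦌))
    ((toCosk n Z).app (op ⦋n + 1⦌))
  let T : Over X := Over.mk (q ≫ P.hom)
  let q' : T ⟶ P := Over.homMk q rfl
  let z : T ⟶ Z _⦋n + 1⦌ := q' ≫ pullback.snd _ _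
  let y {Γ : SimplexCategory} (h : Γ.len ≤ n) (θ : Γ ⟶ ⦋n + 1⦌) : T ⟶ hB.refinement.obj (op Γ) :=
    q' ≫ pullback.fst _ _ ≫ coskProj hB.refinement h θ
  have hyz {Γ : SimplexCategory} (h : Γ.len ≤ n) (θ : Γ ⟶ ⦋n + 1⦌) :
      y h θ ≫ hB.refinementHom.app (op Γ) = z ≫ Z.map θ.op := by
    simp only [y, z, Category.assoc]
    rw [← cosk_map_coskProj, pullback.condition_assoc, toCosk_coskProj]
  have hymap {Γ Γ' : SimplexCategory} (h : Γ.len ≤ n) (h' : Γ'.len ≤ n) (φ : Γ' ⟶ Γ)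
      (θ : Γ ⟶ ⦋n + 1⦌) : y h θ ≫ hB.refinement.map φ.op = y h' (φ ≫ θ) := by
    simp only [y, Category.assoc]
    rw [coskProj_map]
  let yl {Γ : SimplexCategory} (h : Γ.len ≤ n) (θ : Γ ⟶ ⦋n + 1⦌) :
      Spec (CommRingCat.of K) ⟶ hB.union (op Γ) := (y h θ).left
  have hyl {Γ : SimplexCategory} (h : Γ.len ≤ n) (θ : Γ ⟶ ⦋n + 1⦌) :
      yl h θ ≫ hB.toZ (op Γ) = z.left ≫ (Z.map θ.op).left :=
    congrArg (·.left) (hyz h θ)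
  have hylmap {Γ Γ' : SimplexCategory} (h : Γ.len ≤ n) (h' : Γ'.len ≤ n) (φ : Γ' ⟶ Γ)
      (θ : Γ ⟶ ⦋n + 1⦌) : yl h θ ≫ hB.unionMap φ.op = yl h' (φ ≫ θ) :=
    congrArg (·.left) (hymap h h' φ θ)
  choose t ht hyt using fun (Γ : SimplexCategory) (h : Γ.len ≤ n) (θ : Γ ⟶ ⦋n + 1⦌) ↦
    hB.exists_eq_lift (yl h θ)
  -- The spectrum of `K` is a single point, so `zl` maps into an open set once it maps `x₀` into it.
  let zl : Spec (CommRingCat.of K) ⟶ (Z _⦋n + 1⦌).left := z.left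
  let x₀ : Spec (CommRingCat.of K) := Classical.arbitrary _
  obtain ⟨t', hxt', ht'⟩ := hB'.exists_extension (fun Γ h θ ↦ t Γ h θ)
    (fun Γ Γ' h h' φ θ ↦ by
      have e : hB.lift (t Γ' h' (φ ≫ θ)) _ (ht Γ' h' (φ ≫ θ)) =
          hB.lift ((t Γ h θ).pullback φ) _ (hB.map_mem_opens φ.op _ _ (ht Γ h θ)) :=
        (hyt Γ' h' (φ ≫ θ)).symm.trans ((hylmap h h' φ θ).symm.trans
          ((congrArg (· ≫ hB.unionMap φ.op) (hyt Γ h θ)).trans (hB.lift_unionMap _ _)))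
      exact hB.eq_of_lift_eq_lift _ e)
    (zl x₀) (fun Γ h θ ↦ by
      have := ht Γ h θ x₀
      rw [hyl] at this
      exact this)
  have hzt' (x) : zl x ∈ hB.opens (Δ := op ⦋n + 1⦌) t' := by
    rw [Subsingleton.elim x x₀]
    exact hxt'
  let yl' : Spec (CommRingCat.of K) ⟶ hB.union (op ⦋n + 1⦌) := hB.lift (Δ := op ⦋n + 1⦌) t' zl hzt'
  have hyl' : yl' ≫ hB.toZ (op ⦋n + 1⦌) = zl := hB.lift_toZ _
  let y' : T ⟶ hB.refinement _⦋n + 1⦌ := Over.homMk yl' (by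
    change yl' ≫ hB.toZ (op ⦋n + 1⦌) ≫ (Z _⦋n + 1⦌).hom = _
    rw [← Category.assoc, hyl']
    exact Over.w z)
  suffices y' ≫ toRelativeCosk hB.refinementHom n = q' from
    ⟨yl', congrArg (·.left) this⟩
  refine pullback.hom_ext ?_ ?_
  · rw [Category.assoc, toRelativeCosk_fst]
    refine cosk_hom_ext _ fun Γ h θ ↦ ?_
    rw [Category.assoc, toCosk_coskProj, Category.assoc]
    refine Over.OverMorphism.ext ?_
    change yl' ≫ hB.unionMap θ.op = yl h θ
    rw [hyt, lift_unionMap]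
    exact hB.lift_congr _ (ht' h θ) (hyl h θ).symm _
  · rw [Category.assoc, toRelativeCosk_snd]
    exact Over.OverMorphism.ext hyl'

/-- The disjoint unions are affine, hence separated over `X`. The surjectivity of the morphism to the
coskeleton follows from that of the morphism to the relative coskeleton, whose projection to the
coskeleton is a base change of `Z_{n+1} ⟶ cosk_n(Z)_{n+1}`. -/
lemma isEtaleHypercovering_refinement (hB' : IsCoveringBasis (points Z) B)
    (hZ : IsEtaleHypercovering Z) (haff : ∀ n : ℕ, IsAffine (hB.union (op ⦋n⦌)))
    (hqs : ∀ n : ℕ, QuasiSeparatedSpace (Z _⦋n⦌).left) :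
    IsEtaleHypercovering hB.refinement where
  isSeparated n := by
    have : IsAffine (hB.refinement _⦋n⦌).left := haff n
    infer_instance
  locallyOfFiniteType n := by
    have := hB.etale_refinement hZ.etale n
    infer_instance
  quasiCompact n := by
    have := haff n
    have := hqs n
    have := hZ.quasiCompact n
    exact inferInstanceAs (QuasiCompact (hB.toZ (op ⦋n⦌) ≫ (Z _⦋n⦌).hom))
  etale_zero := hB.etale_refinement hZ.etale 0
  surjective_zero := by
    have := hB.surjective_toZ hB' (op ⦋0⦌)
    have := hZ.surjective_zero
    exact inferInstanceAs (Surjective (hB.toZ (op ⦋0⦌) ≫ (Z _⦋0⦌).hom))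
  etale_succ n := by
    have := hB.etale_refinement hZ.etale (n + 1)
    have := etale_cosk hB.refinement n (fun m _ ↦ hB.etale_refinement hZ.etale m) ⦋n + 1⦌
    exact etale_left _
  surjective_succ n := by
    have := hB.surjective_toRelativeCosk hB' n
    have := hZ.surjective_succ n
    have h := (IsPullback.of_hasPullback
      (((SimplicialObject.cosk n).map hB.refinementHom).app (op ⦋n + 1⦌))
      ((toCosk n Z).app (op ⦋n + 1⦌))).map (Over.forget X)
    have : Surjective (pullback.fst
        (((SimplicialObject.cosk n).map hB.refinementHom).app (op ⦋n + 1⦌))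
        ((toCosk n Z).app (op ⦋n + 1⦌))).left :=
      MorphismProperty.of_isPullback (P := @Surjective) h.flip ‹_›
    rw [← toRelativeCosk_fst hB.refinementHom n, Over.comp_left]
    infer_instance

lemma isRefinement_refinementHom (hB' : IsCoveringBasis (points Z) B)
    (hZ : IsEtaleHypercovering Z) (hY : IsEtaleHypercovering hB.refinement) :
    IsRefinement hB.refinementHom where
  isEtaleHypercovering := hY
  etale_zero := hB.etale_toZ _
  surjective_zero := hB.surjective_toZ hB' _
  etale_succ n := by
    have := hB.etale_refinement hZ.etale (n + 1)
    have := hZ.etale (n + 1)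
    have := etale_cosk hB.refinement n (fun m _ ↦ hB.etale_refinement hZ.etale m) ⦋n + 1⦌
    have := etale_cosk Z n (fun m _ ↦ hZ.etale m) ⦋n + 1⦌
    have := etale_pullback (((SimplicialObject.cosk n).map hB.refinementHom).app (op ⦋n + 1⦌))
      ((toCosk n Z).app (op ⦋n + 1⦌))
    exact etale_left _
  surjective_succ := hB.surjective_toRelativeCosk hB'

end HasOpenMembers

end EtaleHypercovering

open EtaleHypercovering in
theorem mainTheorem6 {k : Type u} [Field k] {X : Scheme.{u}}
    (s : X ⟶ Spec (CommRingCat.of k)) [QuasiCompact s]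
    (Z : SimplicialObject (Over X)) (hZ : EtaleHypercovering.IsEtaleHypercovering Z)
    (hsmooth : ∀ n : ℕ, Smooth ((Z _⦋n⦌).hom ≫ s)) :
    ∃ (Y : SimplicialObject (Over X)) (f : Y ⟶ Z),
      EtaleHypercovering.IsEtaleHypercovering Y ∧
      EtaleHypercovering.IsRefinement f ∧
      ∀ n : ℕ, ∃ (r : ℕ) (U : Fin r → (Z _⦋n⦌).left.Opens),
        (∀ i, EtaleHypercovering.IsStandardSmoothScheme k (U i).toScheme
          ((U i).ι ≫ (Z _⦋n⦌).hom ≫ s)) ∧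
        (⨆ i, U i) = ⊤ ∧
        ∃ e : (Y _⦋n⦌).left ≅ ∐ fun i ↦ (U i).toScheme,
          e.hom ≫ Sigma.desc (fun i ↦ (U i).ι) = (f.app (op ⦋n⦌)).left := by
  have hcomp (n : ℕ) : CompactSpace (Z _⦋n⦌).left := by
    have := hZ.quasiCompact n
    exact QuasiCompact.compactSpace_of_compactSpace ((Z _⦋n⦌).hom ≫ s)
  have hqs (n : ℕ) : QuasiSeparatedSpace (Z _⦋n⦌).left := by
    have := hsmooth n
    have := LocallyOfFiniteType.isLocallyNoetherian ((Z _⦋n⦌).hom ≫ s)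
    infer_instance
  obtain ⟨B, hB', hBs⟩ := exists_isCoveringBasis s Z hZ.etale hsmooth hcomp
  have hB : HasOpenMembers B := fun Γ V hV ↦ by
    obtain ⟨U, rfl, -⟩ := hBs Γ V hV
    exact U.isOpen
  have hstd (n : ℕ) (t : SetSystem (points Z) B ⦋n⦌) :
      IsStandardSmoothScheme k (hB.opens (Δ := op ⦋n⦌) t).toScheme
        ((hB.opens (Δ := op ⦋n⦌) t).ι ≫ (Z _⦋n⦌).hom ≫ s) := by
    obtain ⟨U, hU, h⟩ := hBs _ _ t.top_mem
    obtain rfl : U = hB.opens (Δ := op ⦋n⦌) t := TopologicalSpace.Opens.ext hU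
    exact h
  have hfin (n : ℕ) : Finite (SetSystem (points Z) B ⦋n⦌) := SetSystem.finite hB' _
  have haff (n : ℕ) : IsAffine (hB.union (op ⦋n⦌)) := by
    have (t : SetSystem (points Z) B ⦋n⦌) : IsAffine (hB.opens (Δ := op ⦋n⦌) t).toScheme :=
      (hstd n t).isAffine
    exact inferInstanceAs (IsAffine (∐ fun t : SetSystem (points Z) B ⦋n⦌ ↦
      (hB.opens (Δ := op ⦋n⦌) t).toScheme))
  have hY := hB.isEtaleHypercovering_refinement hB' hZ haff hqs
  refine ⟨hB.refinement, hB.refinementHom, hY, hB.isRefinement_refinementHom hB' hZ hY,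
    fun n ↦ ?_⟩
  obtain ⟨r, ⟨ε⟩⟩ := Finite.exists_equiv_fin (SetSystem (points Z) B ⦋n⦌)
  refine ⟨r, fun i ↦ hB.opens (Δ := op ⦋n⦌) (ε.symm i), fun i ↦ hstd n _, ?_, ?_⟩
  · refine eq_top_iff.mpr fun x _ ↦ ?_
    obtain ⟨t, ht⟩ := hB'.exists_mem_top (Δ := ⦋n⦌) x
    refine TopologicalSpace.Opens.mem_iSup.mpr ⟨ε t, (?_ : x ∈ hB.opens (Δ := op ⦋n⦌) (ε.symm (ε t)))⟩
    rw [ε.symm_apply_apply]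
    exact ht
  · let e := Sigma.reindex ε.symm
      (fun t : SetSystem (points Z) B ⦋n⦌ ↦ (hB.opens (Δ := op ⦋n⦌) t).toScheme)
    refine ⟨e.symm, ?_⟩
    refine (Iso.inv_comp_eq e).mpr (Sigma.hom_ext _ _ fun i ↦ ?_)
    rw [Sigma.ι_desc]
    refine Eq.trans ?_ (congrArg (· ≫ hB.toZ (op ⦋n⦌))
      (Sigma.ι_reindex_hom ε.symm _ i)).symm
    exact (hB.incl_desc (Δ := op ⦋n⦌) (ε.symm i) fun t ↦ (hB.opens t).ι).symm
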